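/- For $c\ge 1$ let $\mathcal N_c$ be the class of all groups that are nilpotent of class at most $c$. For a class $\mathcal V$ of groups (regarded as a full subcategory of the category of groups), a group $G\in\mathcal V$ and a subgroup $H\le G$, the dominion of $H$ in $G$ in $\mathcal V$ is $$\mathrm{dom}_G^{\mathcal V}(H)=\{a\in G : \text{for all } C\in\mathcal V \text{ and all homomorphisms } f,g\colon G\to C,\ f|_H=g|_H \text{ implies } f(a)=g(a)\};$$ $\mathcal V$ is said to have nontrivial dominions if $\mathrm{dom}_G^{\mathcal V}(H)\ne H$ for some $G\in\mathcal V$ and some subgroup $H\le G$. Write $[x,y]=x^{-1}y^{-1}xy$. Fix an integer $c>1$, and let $G$ be the relatively free nilpotent group of class two on two generators $x,y$ (the quotient of the free group on $x,y$ by the third term of its lower central series). For a prime $p$ put $H_p=\langle x^p,y^p\rangle\le G$. (1) For every prime $p\ge c$, $$\mathrm{dom}_G^{\mathcal N_c}(H_p)=\langle x^p,\,y^p,\,[x,y]^p\rangle;$$ moreover $\mathrm{dom}_G^{\mathcal N_c}(H_p)=\mathrm{dom}_G^{\mathcal N_2}(H_p)$, and this subgroup properly contains $H_p$. (2) Every class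 of groups $\mathcal V$ with $\mathcal N_2\subseteq\mathcal V\subseteq\mathcal N_c$ has nontrivial dominions. Namely, for every prime $p\ge c$, $$H_p\subsetneq \mathrm{dom}_G^{\mathcal N_2}(H_p)=\mathrm{dom}_G^{\mathcal V}(H_p).$$ -/

import Mathlib

universe u

open CategoryTheory

/-- The dominion of a subgroup `H` of `G` in the full subcategory of groups with object class `V`:
the elements of `G` on which any two homomorphisms from `G` to a member of `V` agree
as soon as they agree on `H`. (It is meant for `G` in `V`.) -/
def dominion (V : ObjectProperty GrpCat.{u}) {G : Type u} [Group G] (H : Subgroup G) :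
    Subgroup G where
  carrier := {a | ∀ C : GrpCat.{u}, V C → ∀ f g : G →* C, (∀ h ∈ H, f h = g h) → f a = g a}
  one_mem' := by
    intro C _ f g _
    rw [map_one, map_one]
  mul_mem' := by
    intro a b ha hb C hC f g h
    rw [map_mul, map_mul, ha C hC f g h, hb C hC f g h]
  inv_mem' := by
    intro a ha C hC f g h
    rw [map_inv, map_inv, ha C hC f g h]

/-- The class of all groups that are nilpotent of class at most `c`. Mathlib numbers the lower
central series from `0`, so this is the term usually written `G_{c+1}`. -/
def nilpotentGroups (c : ℕ) : ObjectProperty GrpCat.{u} :=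
  fun G => (⊤ : Subgroup G).lowerCentralSeries c = ⊥

/-- A full subcategory of groups has nontrivial dominions if some subgroup of one of its
objects differs from its dominion. -/
def HasNontrivialDominions (V : ObjectProperty GrpCat.{u}) : Prop :=
  ∃ G : GrpCat.{u}, V G ∧ ∃ H : Subgroup G, dominion V H ≠ H

/-- The commutator `x⁻¹ y⁻¹ x y`. -/
def groupComm {G : Type u} [Group G] (x y : G) : G := x⁻¹ * y⁻¹ * x * y

/-- The free nilpotent group of class two on two generators: the quotient of the free group of
rank two by the third term of its lower central series. -/
abbrev FreeNilTwo : Type u :=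
  FreeGroup (ULift.{u} (Fin 2)) ⧸
    (⊤ : Subgroup (FreeGroup (ULift.{u} (Fin 2)))).lowerCentralSeries 2

namespace FreeNilTwo

/-- The first free generator. -/
def x : FreeNilTwo.{u} := QuotientGroup.mk (FreeGroup.of (ULift.up 0))

/-- The second free generator. -/
def y : FreeNilTwo.{u} := QuotientGroup.mk (FreeGroup.of (ULift.up 1))

/-- The subgroup generated by the `p`-th powers of the two free generators. -/
def powers (p : ℕ) : Subgroup FreeNilTwo.{u} := Subgroup.closure {x ^ p, y ^ p}

theorem mem_nilpotentGroups : nilpotentGroups 2 (GrpCat.of FreeNilTwo.{u}) := by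
  change (⊤ : Subgroup FreeNilTwo.{u}).lowerCentralSeries 2 = ⊥
  have h := Subgroup.map_lowerCentralSeries (⊤ : Subgroup (FreeGroup (ULift.{u} (Fin 2))))
    (QuotientGroup.mk' ((⊤ : Subgroup (FreeGroup (ULift.{u} (Fin 2)))).lowerCentralSeries 2)) 2
  rw [Subgroup.map_top_of_surjective _ (QuotientGroup.mk'_surjective _)] at h
  first | rw [h] | rw [← h]
  rw [Subgroup.map_eq_bot_iff, QuotientGroup.ker_mk']

end FreeNilTwo

/-! Dominions shrink as the class of groups grows, so everything follows from bounding the dominion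
above for `N_2` and below for `N_c`; any intermediate class is squeezed. Upper bound: the map of `G`
onto the Heisenberg group over `ZMod p` and the trivial map agree on `H_p`, and the kernel of the
former lies in `⟨x^p, y^p, [x,y]^p⟩`. Lower bound: in `G`, `[x,y]^p = [x,y^p]`. If `f` and `g` agree
on `H_p`, their values there agree as soon as `f x * (g x)⁻¹` commutes with `(f y)^p`. This is
`commute_inv_mul_pow_of_pow_eq`: in class at most `p`, elements with equal `p`-th powers differ by
an element commuting with all `p`-th powers. It rests on the regularity laws for class less than `p`
(`pow_prime_laws`), applied in `⟨g, G'⟩`, whose class is smaller by one. These come from a weak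
Hall–Petrescu identity, proved with polynomial sequences. Properness is seen in the integral
Heisenberg group by divisibility of the corner entry by `p^2`. -/

open scoped commutatorElement

/-! ### Polynomial sequences in a filtered group -/

/-- A sequence in a group is polynomial to order `n` and level `i` for the filtration `F` if its
`k`-th iterated difference takes values in `F (i + k)` for every `k ≤ n`. -/
def IsPolySeq {G : Type*} [Group G] (F : ℕ → Subgroup G) : ℕ → ℕ → (ℕ → G) → Prop
  | 0, i, f => ∀ m, f m ∈ F i
  | n + 1, i, f => IsPolySeq F n i f ∧ IsPolySeq F n (i + 1) fun m => (f m)⁻¹ * f (m + 1)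

namespace IsPolySeq

variable {G : Type*} [Group G] {F : ℕ → Subgroup G}

theorem mono (hF : Antitone F) {n i j : ℕ} (hij : i ≤ j) {f : ℕ → G} (hf : IsPolySeq F n j f) :
    IsPolySeq F n i f := by
  induction n generalizing i j f with
  | zero => exact fun m => hF hij (hf m)
  | succ n ih => exact ⟨ih hij hf.1, ih (Nat.succ_le_succ hij) hf.2⟩

theorem one (n i : ℕ) : IsPolySeq F n i fun _ => 1 := by
  induction n generalizing i with
  | zero => exact fun _ => one_mem _
  | succ n ih => exact ⟨ih i, by simpa using ih (i + 1)⟩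

/-- The three closure properties are proved by one induction on the order, since the difference of a
product, inverse or commutator is built from conjugates and commutators of sequences of lower order.
-/
theorem group_laws (hF : Antitone F) (hc : ∀ i j, ⁅F i, F j⁆ ≤ F (i + j)) (n : ℕ) :
    (∀ i f g, IsPolySeq F n i f → IsPolySeq F n i g → IsPolySeq F n i fun m => f m * g m) ∧
    (∀ i f, IsPolySeq F n i f → IsPolySeq F n i fun m => (f m)⁻¹) ∧
    (∀ i j f g, IsPolySeq F n i f → IsPolySeq F n j g →
      IsPolySeq F n (i + j) fun m => ⁅f m, g m⁆) := by
  induction n with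
  | zero =>
    exact ⟨fun i f g hf hg m => mul_mem (hf m) (hg m), fun i f hf m => inv_mem (hf m),
      fun i j f g hf hg m => hc i j (Subgroup.commutator_mem_commutator (hf m) (hg m))⟩
  | succ n ih =>
    obtain ⟨hmul, hinv, hcomm⟩ := ih
    have hconj : ∀ i j f g, IsPolySeq F n i f → IsPolySeq F n j g →
        IsPolySeq F n j fun m => f m * g m * (f m)⁻¹ := by
      intro i j f g hf hg
      have := hmul j _ _ ((hcomm i j f g hf hg).mono hF (by omega)) hg
      simpa [commutatorElement_def] using this
    refine ⟨fun i f g hf hg => ⟨hmul i f g hf.1 hg.1, ?_⟩, fun i f hf => ⟨hinv i f hf.1, ?_⟩,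
      fun i j f g hf hg => ⟨hcomm i j f g hf.1 hg.1, ?_⟩⟩
    · have := hmul _ _ _ (hconj _ _ _ _ (hinv _ _ hg.1) hf.2) hg.2
      convert this using 2
      group
    · have := hconj _ _ _ _ hf.1 (hinv _ _ hf.2)
      convert this using 2
      group
    · have hg' := hmul _ _ _ hg.1 (hg.2.mono hF (Nat.le_succ j))
      have hX := hconj _ _ _ _ hf.1 (hcomm _ _ _ _ hf.2 hg')
      have hY := hconj _ _ _ _ hg.1 (hcomm _ _ _ _ hf.1 hg.2)
      rw [show i + 1 + j = i + j + 1 by omega] at hX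
      have := hmul _ _ _ (hconj _ _ _ _ (hinv _ _ (hcomm _ _ _ _ hf.1 hg.1)) hX) hY
      convert this using 2
      simp only [commutatorElement_def]
      group

/-- If the first `k` values are trivial, the `k`-th iterated difference at `0` is just `f k`. -/
theorem apply_mem {k i : ℕ} {f : ℕ → G} (hf : IsPolySeq F k i f) (h : ∀ j < k, f j = 1) :
    f k ∈ F (i + k) := by
  induction k generalizing i f with
  | zero => exact hf 0
  | succ k ih =>
    have := ih hf.2 fun j hj => by rw [h j (by omega), h (j + 1) (by omega)]; simp
    rw [h k (by omega)] at this
    rw [show i + (k + 1) = i + 1 + k by omega]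
    simpa using this

theorem of_le {n k i : ℕ} (h : k ≤ n) {f : ℕ → G} (hf : IsPolySeq F n i f) :
    IsPolySeq F k i f := by
  induction n, h using Nat.le_induction with
  | base => exact hf
  | succ n _ ih => exact ih hf.1

theorem pow_choose (hF : Antitone F) (n : ℕ) {k i : ℕ} {c : G} (hc : c ∈ F (i + k)) :
    IsPolySeq F n i fun m => c ^ m.choose k := by
  induction n generalizing k i with
  | zero => exact fun m => pow_mem (hF (Nat.le_add_right i k) hc) _
  | succ n ih =>
    refine ⟨ih hc, ?_⟩
    cases k with
    | zero => simpa using one n (i + 1)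
    | succ k =>
      convert ih (k := k) (i := i + 1) (by rwa [show i + 1 + k = i + (k + 1) by omega]) using 2
      dsimp only
      rw [Nat.choose_succ_succ', add_comm (Nat.choose _ k), pow_add, inv_mul_cancel_left]

/-- A polynomial sequence starting with `1, 1` has its `p`-th value deep in the filtration, when
`F 2` has exponent `p`. -/
theorem apply_prime_mem (hF : Antitone F) (hc : ∀ i j, ⁅F i, F j⁆ ≤ F (i + j)) {p : ℕ}
    (hp : p.Prime) (hexp : ∀ d ∈ F 2, d ^ p = 1) {f : ℕ → G} (hf : IsPolySeq F p 0 f)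
    (h0 : f 0 = 1) (h1 : f 1 = 1) : f p ∈ F p := by
  obtain ⟨hmul, hinv, -⟩ := group_laws hF hc p
  have key : ∀ k, 2 ≤ k → k ≤ p →
      ∃ g, IsPolySeq F p 0 g ∧ (∀ j < k, g j = 1) ∧ g p = f p := by
    intro k hk
    induction k, hk using Nat.le_induction with
    | base =>
      refine fun _ => ⟨f, hf, fun j hj => ?_, rfl⟩
      interval_cases j
      exacts [h0, h1]
    | succ k hk ih =>
      intro hkp
      obtain ⟨g, hg, hg1, hgp⟩ := ih (by omega)
      have hmem : g k ∈ F (0 + k) := (hg.of_le (by omega)).apply_mem hg1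
      -- Dividing by the leading binomial term kills the value at `k`. The value at `p` is
      -- unchanged, as `p ∣ p.choose k` and `g k` lies in `F 2`.
      refine ⟨fun m => g m * (g k ^ m.choose k)⁻¹,
        hmul _ _ _ hg (hinv _ _ (pow_choose hF p hmem)), fun j hj => ?_, ?_⟩
      · rcases Nat.lt_succ_iff_lt_or_eq.mp hj with hj | rfl
        · simp [hg1 j hj, Nat.choose_eq_zero_of_lt hj]
        · simp
      · obtain ⟨q, hq⟩ := hp.dvd_choose_self (k := k) (by omega) (by omega)
        have : g k ^ p = 1 := hexp _ (hF (by omega) hmem)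
        simp [hgp, hq, pow_mul, this]
  obtain ⟨g, hg, hg1, hgp⟩ := key p hp.two_le le_rfl
  simpa [hgp] using hg.apply_mem hg1

end IsPolySeq

/-! ### The lower central series and a Hall–Petrescu identity -/

namespace Subgroup

variable {G : Type*} [Group G]

/-- The three subgroups lemma modulo a normal subgroup. -/
theorem commutator_commutator_le_of_rotate {A B C N : Subgroup G} [N.Normal]
    (h1 : ⁅⁅B, C⁆, A⁆ ≤ N) (h2 : ⁅⁅C, A⁆, B⁆ ≤ N) : ⁅⁅A, B⁆, C⁆ ≤ N := by
  have hN : ∀ K : Subgroup G, K ≤ N ↔ K.map (QuotientGroup.mk' N) = ⊥ := fun K => by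
    rw [map_eq_bot_iff, QuotientGroup.ker_mk']
  rw [hN, map_commutator, map_commutator] at *
  exact commutator_commutator_eq_bot_of_rotate h1 h2

theorem commutator_lowerCentralSeries_le (i j : ℕ) :
    ⁅(⊤ : Subgroup G).lowerCentralSeries i, (⊤ : Subgroup G).lowerCentralSeries j⁆ ≤
      (⊤ : Subgroup G).lowerCentralSeries (i + j + 1) := by
  induction j generalizing i with
  | zero => exact le_rfl
  | succ j ih =>
    rw [commutator_comm]
    refine commutator_commutator_le_of_rotate ?_ ?_
    · rw [commutator_comm ⊤]
      exact (ih (i + 1)).trans (by rw [show i + 1 + j + 1 = i + (j + 1) + 1 by omega])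
    · exact (commutator_mono (ih i) le_rfl)

/-- A weak form of the Hall–Petrescu identity: if the commutator subgroup has exponent `p`, then
taking `p`-th powers is multiplicative modulo the `p`-th term of the lower central series. -/
theorem exists_mul_pow_eq {p : ℕ} (hp : p.Prime)
    (hexp : ∀ d ∈ (⊤ : Subgroup G).lowerCentralSeries 1, d ^ p = 1) (x y : G) :
    ∃ t ∈ (⊤ : Subgroup G).lowerCentralSeries (p - 1), (x * y) ^ p = x ^ p * y ^ p * t := by
  have hanti := lowerCentralSeries_antitone (⊤ : Subgroup G)
  -- Truncated subtraction gives `F 0 = F 1 = ⊤`, so `m ↦ g ^ m`, with constant difference `g`, has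
  -- level `0`.
  let F : ℕ → Subgroup G := fun i => (⊤ : Subgroup G).lowerCentralSeries (i - 1)
  have hF : Antitone F := fun i j hij => hanti (Nat.sub_le_sub_right hij 1)
  have hc : ∀ i j, ⁅F i, F j⁆ ≤ F (i + j) := by
    intro i j
    rcases Nat.eq_zero_or_pos i with rfl | hi
    · rw [zero_add]; exact commutator_le_right _ _
    rcases Nat.eq_zero_or_pos j with rfl | hj
    · exact commutator_le_left _ _
    refine (commutator_lowerCentralSeries_le _ _).trans (hanti (by omega))
  have hlin : ∀ g : G, IsPolySeq F p 0 fun m => g ^ m := fun g => by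
    simpa using IsPolySeq.pow_choose hF p (k := 1) (i := 0) (c := g) (mem_top g)
  obtain ⟨hmul, hinv, -⟩ := IsPolySeq.group_laws hF hc p
  -- The sequence `(x^m y^m)⁻¹ (xy)^m` is trivial at `0` and `1`; its value at `p` is the error term
  -- `t`.
  have := IsPolySeq.apply_prime_mem hF hc hp hexp
    (hmul _ _ _ (hinv _ _ (hmul _ _ _ (hlin x) (hlin y))) (hlin (x * y))) (by simp) (by simp)
  exact ⟨_, this, by group⟩

end Subgroup

/-! ### Regularity of `p`-th powers in small class -/

namespace Subgroup

section

variable {G : Type*} [Group G]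

theorem commutator_closure_le {S : Set G} {N : Subgroup G} [N.Normal]
    (h : ∀ a ∈ S, ∀ b ∈ S, ⁅a, b⁆ ∈ N) : ⁅closure S, closure S⁆ ≤ N := by
  rw [← QuotientGroup.ker_mk' N, ← map_eq_bot_iff, map_commutator, MonoidHom.map_closure,
    commutator_self_eq_bot_iff]
  refine isMulCommutative_closure ?_
  rintro _ ⟨a, ha, rfl⟩ _ ⟨b, hb, rfl⟩
  rw [← commutatorElement_eq_one_iff_mul_comm, ← map_commutatorElement, ← MonoidHom.mem_ker,
    QuotientGroup.ker_mk']
  exact h a ha b hb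

theorem commutatorElement_mem_lowerCentralSeries_one (a b : G) :
    ⁅a, b⁆ ∈ (⊤ : Subgroup G).lowerCentralSeries 1 :=
  commutator_mem_commutator (mem_top a) (mem_top b)

variable (G) in
/-- The subgroup generated by an element and the commutator subgroup. -/
def adjoinCommutator (x : G) : Subgroup G :=
  closure (insert x ((⊤ : Subgroup G).lowerCentralSeries 1 : Set G))

theorem self_mem_adjoinCommutator (x : G) : x ∈ adjoinCommutator G x :=
  subset_closure (Set.mem_insert _ _)

theorem lowerCentralSeries_one_le_adjoinCommutator (x : G) :
    (⊤ : Subgroup G).lowerCentralSeries 1 ≤ adjoinCommutator G x :=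
  fun _ hg => subset_closure (Set.mem_insert_of_mem _ hg)

theorem conj_mem_adjoinCommutator (x g : G) : g * x * g⁻¹ ∈ adjoinCommutator G x := by
  have := mul_mem (lowerCentralSeries_one_le_adjoinCommutator x
    (commutatorElement_mem_lowerCentralSeries_one g x)) (self_mem_adjoinCommutator x)
  simpa [commutatorElement_def] using this

/-- The generator `x` commutes with itself, so every commutator of generators involves an element of
`G'` and falls into the next term. -/
theorem adjoinCommutator_lowerCentralSeries_le (x : G) (k : ℕ) :
    (adjoinCommutator G x).lowerCentralSeries (k + 1) ≤
      (⊤ : Subgroup G).lowerCentralSeries (k + 2) := by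
  induction k with
  | zero =>
    refine commutator_closure_le ?_
    have h : ∀ g : G, ∀ d ∈ (⊤ : Subgroup G).lowerCentralSeries 1,
        ⁅d, g⁆ ∈ (⊤ : Subgroup G).lowerCentralSeries 2 :=
      fun g d hd => commutator_mem_commutator hd (mem_top g)
    rintro a ha b (rfl | hb)
    · rcases ha with rfl | ha
      · rw [commutatorElement_self]
        exact one_mem _
      · exact h _ _ ha
    · rw [← commutatorElement_inv]
      exact inv_mem (h _ _ hb)
  | succ k ih => exact commutator_mono ih le_top

theorem adjoinCommutator_lowerCentralSeries_eq_bot (x : G) {k : ℕ} (hk : 1 ≤ k)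
    (h : (⊤ : Subgroup G).lowerCentralSeries (k + 1) = ⊥) :
    (⊤ : Subgroup (adjoinCommutator G x)).lowerCentralSeries k = ⊥ := by
  obtain ⟨k, rfl⟩ := Nat.exists_eq_add_of_le' hk
  apply map_injective (subtype_injective _)
  rw [top_subtype_lowerCentralSeries, map_bot, eq_bot_iff, ← h]
  exact adjoinCommutator_lowerCentralSeries_le x k

/-- The elements of `G'` of exponent `p` form a normal subgroup containing `[x,y]`, hence the
derived subgroup of `⟨x, y⟩`; the identity applies there. -/
theorem exists_mul_pow_eq_of_commutatorElement_pow_eq_one {p : ℕ} (hp : p.Prime)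
    (hmul : ∀ a ∈ (⊤ : Subgroup G).lowerCentralSeries 1,
      ∀ b ∈ (⊤ : Subgroup G).lowerCentralSeries 1, a ^ p = 1 → b ^ p = 1 → (a * b) ^ p = 1)
    {x y : G} (hxy : ⁅x, y⁆ ^ p = 1) :
    ∃ t ∈ (⊤ : Subgroup G).lowerCentralSeries (p - 1), (x * y) ^ p = x ^ p * y ^ p * t := by
  let T : Subgroup G :=
    { carrier := {g | g ∈ (⊤ : Subgroup G).lowerCentralSeries 1 ∧ g ^ p = 1}
      one_mem' := ⟨one_mem _, one_pow p⟩
      mul_mem' := fun ha hb => ⟨mul_mem ha.1 hb.1, hmul _ ha.1 _ hb.1 ha.2 hb.2⟩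
      inv_mem' := fun ha => ⟨inv_mem ha.1, by rw [inv_pow, ha.2, inv_one]⟩ }
  have hmem : ∀ {g : G}, g ^ p = 1 → g ∈ (⊤ : Subgroup G).lowerCentralSeries 1 → g ∈ T :=
    fun h1 h2 => ⟨h2, h1⟩
  have : T.Normal := ⟨fun g hg a => hmem (by rw [conj_pow, hg.2]; simp)
    (Normal.conj_mem inferInstance g hg.1 a)⟩
  let H := closure {x, y}
  have hH : H.lowerCentralSeries 1 ≤ T := by
    have hx := hmem hxy (commutatorElement_mem_lowerCentralSeries_one x y)
    refine commutator_closure_le ?_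
    rintro a (rfl | rfl) b (rfl | rfl)
    · rw [commutatorElement_self]; exact one_mem _
    · exact hx
    · rw [← commutatorElement_inv]; exact inv_mem hx
    · rw [commutatorElement_self]; exact one_mem _
  obtain ⟨t, ht, h⟩ := exists_mul_pow_eq (G := H) hp (fun d hd => by
    have : (d : G) ∈ H.lowerCentralSeries 1 := by
      rw [← top_subtype_lowerCentralSeries]
      exact mem_map_of_mem H.subtype hd
    exact Subtype.ext (hH this).2) ⟨x, subset_closure (by simp)⟩ ⟨y, subset_closure (by simp)⟩
  refine ⟨t, lowerCentralSeries_mono _ (le_top (a := H)) ?_, congrArg Subtype.val h⟩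
  dsimp only
  rw [← top_subtype_lowerCentralSeries]
  exact mem_map_of_mem H.subtype ht

end

/-- In a group of class less than `p`, the elements of exponent `p` form a subgroup, and two
elements have the same `p`-th power precisely when they agree modulo that subgroup. -/
theorem pow_prime_laws {p : ℕ} (hp : p.Prime) {k : ℕ} (hk : 1 ≤ k) (hkp : k < p) :
    ∀ (G : Type u) [Group G], (⊤ : Subgroup G).lowerCentralSeries k = ⊥ → ∀ x y : G,
      (x ^ p = 1 → y ^ p = 1 → (x * y) ^ p = 1) ∧ (x ^ p = y ^ p → (x⁻¹ * y) ^ p = 1) ∧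
        ((x⁻¹ * y) ^ p = 1 → x ^ p = y ^ p) := by
  induction k, hk using Nat.le_induction with
  | base =>
    intro G _ h x y
    have hc : ∀ a b : G, Commute a b := fun a b => by
      rw [← commutatorElement_eq_one_iff_commute, ← mem_bot, ← h]
      exact commutatorElement_mem_lowerCentralSeries_one a b
    rw [(hc x y).mul_pow, (hc x⁻¹ y).mul_pow, inv_pow, inv_mul_eq_one]
    exact ⟨fun hx hy => by rw [hx, hy, one_mul], id, id⟩
  | succ k hk ih =>
    intro G _ h
    have hA : ∀ g u v : G, u ∈ adjoinCommutator G g → v ∈ adjoinCommutator G g →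
        (u ^ p = 1 → v ^ p = 1 → (u * v) ^ p = 1) ∧ (u ^ p = v ^ p → (u⁻¹ * v) ^ p = 1) := by
      intro g u v hu hv
      have := ih (by omega) _ (adjoinCommutator_lowerCentralSeries_eq_bot g hk h)
        ⟨u, hu⟩ ⟨v, hv⟩
      simp only [Subtype.ext_iff] at this
      exact ⟨this.1, this.2.1⟩
    have hQ : ∀ a b : G, ⁅a, b⁆ ^ p = 1 → (a * b) ^ p = a ^ p * b ^ p := by
      intro a b hab
      obtain ⟨t, ht, heq⟩ := exists_mul_pow_eq_of_commutatorElement_pow_eq_one hp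
        (fun u hu v hv => (hA 1 u v (lowerCentralSeries_one_le_adjoinCommutator 1 hu)
          (lowerCentralSeries_one_le_adjoinCommutator 1 hv)).1) hab
      have : t ∈ (⊤ : Subgroup G).lowerCentralSeries (k + 1) :=
        lowerCentralSeries_antitone _ (by omega) ht
      rw [h, mem_bot] at this
      rw [heq, this, mul_one]
    -- `[a,b]` is the product of `a` and a conjugate of `a⁻¹`, both of exponent `p` in `⟨a, G'⟩`.
    have h1 : ∀ a b : G, a ^ p = 1 → ⁅a, b⁆ ^ p = 1 := by
      intro a b ha
      have := (hA a a (b * a * b⁻¹)⁻¹ (self_mem_adjoinCommutator a)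
        (inv_mem (conj_mem_adjoinCommutator a b))).1 ha (by rw [inv_pow, conj_pow, ha]; simp)
      rwa [show a * (b * a * b⁻¹)⁻¹ = ⁅a, b⁆ by simp [commutatorElement_def, mul_assoc]] at this
    intro x y
    refine ⟨fun hx hy => ?_, fun hxy => ?_, fun hxy => ?_⟩
    · rw [hQ x y (h1 x y hx), hx, hy, one_mul]
    -- Since `x^p = y^p` commutes with `y`, `x` and its conjugate by `y` have equal `p`-th powers.
    · have := (hA x x (y * x * y⁻¹) (self_mem_adjoinCommutator x)
        (conj_mem_adjoinCommutator x y)).2 (by rw [conj_pow, hxy]; group)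
      rw [hQ x⁻¹ y, inv_pow, hxy, inv_mul_cancel]
      rwa [show x⁻¹ * (y * x * y⁻¹) = ⁅x⁻¹, y⁆ by simp [commutatorElement_def, mul_assoc]] at this
    · have := hQ x (x⁻¹ * y) (by
        rw [← commutatorElement_inv, inv_pow, h1 _ _ hxy, inv_one])
      rw [mul_inv_cancel_left, hxy, mul_one] at this
      exact this.symm

/-- In a group of class at most `p`, the quotient of two elements with the same `p`-th power
commutes with every `p`-th power. -/
theorem commute_inv_mul_pow_of_pow_eq {p : ℕ} (hp : p.Prime) {G : Type u} [Group G]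
    (h : (⊤ : Subgroup G).lowerCentralSeries p = ⊥) {a a' : G} (ha : a ^ p = a' ^ p) (b : G) :
    Commute (a⁻¹ * a') (b ^ p) := by
  have h2 := hp.two_le
  have hp1 : p - 1 + 1 = p := by omega
  have hA : ∀ g u v : G, u ∈ adjoinCommutator G g → v ∈ adjoinCommutator G g →
      (u ^ p = 1 → v ^ p = 1 → (u * v) ^ p = 1) ∧ (u ^ p = v ^ p → (u⁻¹ * v) ^ p = 1) ∧
        ((u⁻¹ * v) ^ p = 1 → u ^ p = v ^ p) := by
    intro g u v hu hv
    have := pow_prime_laws hp (k := p - 1) (by omega) (by omega) _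
      (adjoinCommutator_lowerCentralSeries_eq_bot g (by omega) (hp1.symm ▸ h)) ⟨u, hu⟩ ⟨v, hv⟩
    simp only [Subtype.ext_iff] at this
    exact this
  obtain ⟨z, rfl⟩ : ∃ z, a' = a * z := ⟨a⁻¹ * a', by simp⟩
  rw [inv_mul_cancel_left]
  have haz : ⁅a, z⁆ ^ p = 1 := by
    have := (hA a (a * z * a * (a * z)⁻¹) a (conj_mem_adjoinCommutator a _)
      (self_mem_adjoinCommutator a)).2.1 (by
        rw [conj_pow, ha, (Commute.self_pow (a * z) p).eq, mul_inv_cancel_right])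
    rwa [show (a * z * a * (a * z)⁻¹)⁻¹ * a = ⁅a, z⁆ by
      simp [commutatorElement_def, mul_assoc]] at this
  obtain ⟨t, ht, heq⟩ := exists_mul_pow_eq_of_commutatorElement_pow_eq_one hp
    (fun u hu v hv => (hA 1 u v (lowerCentralSeries_one_le_adjoinCommutator 1 hu)
      (lowerCentralSeries_one_le_adjoinCommutator 1 hv)).1) haz
  have htc : Commute t b := by
    rw [← commutatorElement_eq_one_iff_commute, ← mem_bot, ← h, ← hp1]
    exact commutator_mem_commutator ht (mem_top b)
  -- From `a^p = (az)^p = a^p z^p t` it follows that `z^p = t⁻¹`, and `t` is central.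
  have hz : Commute (z ^ p) b := by
    rw [← ha, mul_assoc, left_eq_mul] at heq
    rw [eq_inv_of_mul_eq_one_left heq]
    exact htc.inv_left
  have h3 := (hA z z (b * z * b⁻¹) (self_mem_adjoinCommutator z)
    (conj_mem_adjoinCommutator z b)).2.1 (by rw [conj_pow, ← hz.eq, mul_inv_cancel_right])
  -- The element of exponent `p` in `h3` is also the quotient of `b⁻¹` and its conjugate by `z⁻¹`,
  -- so these have equal `p`-th powers.
  have h4 := (hA b⁻¹ (z⁻¹ * b⁻¹ * z) b⁻¹ (by simpa using conj_mem_adjoinCommutator b⁻¹ z⁻¹)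
    (self_mem_adjoinCommutator _)).2.2 (by rw [← h3]; simp [mul_assoc])
  have h5 : z⁻¹ * (b ^ p)⁻¹ * z = (b ^ p)⁻¹ := by
    have := conj_pow (i := p) (a := z⁻¹) (b := b⁻¹)
    rw [inv_inv] at this
    rw [← inv_pow, ← this, h4]
  have h6 : Commute z (b ^ p)⁻¹ := by
    rw [commute_iff_eq]
    nth_rewrite 1 [← h5]
    group
  exact Commute.inv_right_iff.mp h6

end Subgroup

/-! ### The Heisenberg group -/

/-- The Heisenberg group over `R`: upper unitriangular `3 × 3` matrices, given by their entries
above the diagonal. -/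
@[ext]
structure HeisenbergGroup (R : Type*) where
  fst : R
  snd : R
  corner : R

namespace HeisenbergGroup

variable {R : Type*} [CommRing R]

instance : Mul (HeisenbergGroup R) :=
  ⟨fun g h => ⟨g.fst + h.fst, g.snd + h.snd, g.corner + h.corner + g.fst * h.snd⟩⟩

instance : One (HeisenbergGroup R) := ⟨⟨0, 0, 0⟩⟩

instance : Inv (HeisenbergGroup R) := ⟨fun g => ⟨-g.fst, -g.snd, -g.corner + g.fst * g.snd⟩⟩

theorem mul_def (g h : HeisenbergGroup R) :
    g * h = ⟨g.fst + h.fst, g.snd + h.snd, g.corner + h.corner + g.fst * h.snd⟩ := rfl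

theorem one_def : (1 : HeisenbergGroup R) = ⟨0, 0, 0⟩ := rfl

theorem inv_def (g : HeisenbergGroup R) :
    g⁻¹ = ⟨-g.fst, -g.snd, -g.corner + g.fst * g.snd⟩ := rfl

instance : Group (HeisenbergGroup R) :=
  Group.ofLeftAxioms (fun _ _ _ => by simp only [mul_def, mk.injEq]; refine ⟨?_, ?_, ?_⟩ <;> ring)
    (fun _ => by simp [mul_def, one_def])
    (fun _ => by simp only [mul_def, one_def, inv_def, mk.injEq]; refine ⟨?_, ?_, ?_⟩ <;> ring)

theorem lowerCentralSeries_two :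
    (⊤ : Subgroup (HeisenbergGroup R)).lowerCentralSeries 2 = ⊥ := by
  have h1 : (⊤ : Subgroup (HeisenbergGroup R)).lowerCentralSeries 1 ≤
      Subgroup.center (HeisenbergGroup R) := by
    refine Subgroup.commutator_le.mpr fun g _ h _ => Subgroup.mem_center_iff.mpr fun k => ?_
    simp only [commutatorElement_def, mul_def, inv_def, mk.injEq]
    refine ⟨?_, ?_, ?_⟩ <;> ring
  exact Subgroup.commutator_top_right_eq_bot_iff_le_center.mpr h1

theorem mk_zpow {a b c : R} (hab : a * b = 0) (n : ℤ) :
    (⟨a, b, c⟩ : HeisenbergGroup R) ^ n = ⟨n * a, n * b, n * c⟩ := by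
  induction n using Int.induction_on with
  | zero => simp [one_def]
  | succ n ih =>
    rw [zpow_add_one, ih]
    simp only [mul_def, mk.injEq]
    push_cast
    exact ⟨by ring, by ring, by linear_combination (n : R) * hab⟩
  | pred n ih =>
    rw [zpow_sub_one, ih]
    simp only [mul_def, inv_def, mk.injEq]
    push_cast
    exact ⟨by ring, by ring, by linear_combination (n + 1 : R) * hab⟩

end HeisenbergGroup

/-! ### Commutators in class two and monotonicity of dominions -/

theorem groupComm_eq_commutatorElement {G : Type*} [Group G] (a b : G) :
    groupComm a b = ⁅a⁻¹, b⁻¹⁆ := by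
  simp [groupComm, commutatorElement_def]

theorem map_groupComm {G K : Type*} [Group G] [Group K] (f : G →* K) (a b : G) :
    f (groupComm a b) = groupComm (f a) (f b) := by
  simp [groupComm]

theorem commute_groupComm {G : Type*} [Group G]
    (h : (⊤ : Subgroup G).lowerCentralSeries 2 = ⊥) (a b g : G) : Commute (groupComm a b) g := by
  rw [← commutatorElement_eq_one_iff_commute, ← Subgroup.mem_bot, ← h,
    groupComm_eq_commutatorElement]
  exact Subgroup.commutator_mem_commutator
    (Subgroup.commutatorElement_mem_lowerCentralSeries_one _ _) (Subgroup.mem_top g)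

/-- `[a,b] b⁻¹` is a conjugate of `b⁻¹`, and its powers split because `[a,b]` is central. -/
theorem groupComm_pow_right {G : Type*} [Group G]
    (h : (⊤ : Subgroup G).lowerCentralSeries 2 = ⊥) (a b : G) (n : ℕ) :
    groupComm a b ^ n = groupComm a (b ^ n) := by
  have h1 : (groupComm a b * b⁻¹) ^ n = a⁻¹ * b⁻¹ ^ n * a := by
    have := conj_pow (i := n) (a := a⁻¹) (b := b⁻¹)
    rw [inv_inv] at this
    rw [← this, groupComm, mul_inv_cancel_right]
  rw [(commute_groupComm h a b _).mul_pow] at h1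
  have h2 : groupComm a (b ^ n) = a⁻¹ * b⁻¹ ^ n * a * b ^ n := by rw [inv_pow]; rfl
  rw [h2, ← h1, inv_pow, inv_mul_cancel_right]

theorem dominion_antitone {V W : ObjectProperty GrpCat.{u}} (h : V ≤ W) {G : Type u} [Group G]
    (H : Subgroup G) : dominion W H ≤ dominion V H :=
  fun _ ha C hC => ha C (h C hC)

theorem le_dominion (V : ObjectProperty GrpCat.{u}) {G : Type u} [Group G] (H : Subgroup G) :
    H ≤ dominion V H :=
  fun _ ha _ _ _ _ h => h _ ha

theorem nilpotentGroups_mono {c d : ℕ} (h : c ≤ d) :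
    nilpotentGroups.{u} c ≤ nilpotentGroups d := fun C (hC : _ = ⊥) =>
  eq_bot_iff.mpr (hC ▸ Subgroup.lowerCentralSeries_antitone (⊤ : Subgroup C) h)

/-! ### Normal form in the free class-two group, and the two bounds -/

namespace FreeNilTwo

theorem lowerCentralSeries_two :
    (⊤ : Subgroup FreeNilTwo.{u}).lowerCentralSeries 2 = ⊥ :=
  mem_nilpotentGroups

@[elab_as_elim]
theorem induction_on {P : FreeNilTwo.{u} → Prop} (g : FreeNilTwo.{u}) (one : P 1)
    (gen_x : P x) (gen_y : P y) (inv_x : P x⁻¹) (inv_y : P y⁻¹)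
    (mul : ∀ g h, P g → P h → P (g * h)) : P g := by
  obtain ⟨g, rfl⟩ := QuotientGroup.mk_surjective g
  refine FreeGroup.induction_on g one ?_ ?_ fun g h hg hh => mul _ _ hg hh
  · rintro ⟨i⟩
    fin_cases i
    exacts [gen_x, gen_y]
  · rintro ⟨i⟩ _
    fin_cases i
    exacts [inv_x, inv_y]

theorem closure_eq_top : Subgroup.closure {x.{u}, y} = ⊤ := by
  have hx : x.{u} ∈ Subgroup.closure {x.{u}, y} := Subgroup.subset_closure (by simp)
  have hy : y.{u} ∈ Subgroup.closure {x.{u}, y} := Subgroup.subset_closure (by simp)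
  rw [Subgroup.eq_top_iff']
  intro g
  induction g using FreeNilTwo.induction_on with
  | one => exact one_mem _
  | gen_x => exact hx
  | gen_y => exact hy
  | inv_x => exact inv_mem hx
  | inv_y => exact inv_mem hy
  | mul g h hg hh => exact mul_mem hg hh

theorem commutator_le_zpowers :
    ⁅(⊤ : Subgroup FreeNilTwo.{u}), ⊤⁆ ≤ Subgroup.zpowers (groupComm x y) := by
  have hz := commute_groupComm lowerCentralSeries_two.{u} x y
  have : (Subgroup.zpowers (groupComm x.{u} y)).Normal := by
    refine ⟨fun g hg a => ?_⟩
    obtain ⟨n, rfl⟩ := hg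
    rw [← ((hz a).zpow_left n).eq, mul_inv_cancel_right]
    exact ⟨n, rfl⟩
  have hxy : ⁅x.{u}, y⁆ ∈ Subgroup.zpowers (groupComm x.{u} y) := by
    have h : ⁅x, y⁆ = x * y * groupComm x.{u} y * (x * y)⁻¹ := by
      simp [groupComm, commutatorElement_def, mul_assoc]
    rw [h, ← (hz _).eq, mul_inv_cancel_right]
    exact Subgroup.mem_zpowers _
  rw [← closure_eq_top]
  refine Subgroup.commutator_closure_le ?_
  rintro a (rfl | rfl) b (rfl | rfl)
  · rw [commutatorElement_self]; exact one_mem _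
  · exact hxy
  · rw [← commutatorElement_inv]; exact inv_mem hxy
  · rw [commutatorElement_self]; exact one_mem _

theorem exists_eq_zpow_mul (g : FreeNilTwo.{u}) :
    ∃ i j k : ℤ, g = x ^ i * y ^ j * groupComm x y ^ k := by
  have hz := commute_groupComm lowerCentralSeries_two.{u} x y
  induction g using FreeNilTwo.induction_on with
  | one => exact ⟨0, 0, 0, by simp⟩
  | gen_x => exact ⟨1, 0, 0, by simp⟩
  | gen_y => exact ⟨0, 1, 0, by simp⟩
  | inv_x => exact ⟨-1, 0, 0, by simp⟩
  | inv_y => exact ⟨0, -1, 0, by simp⟩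
  | mul g h hg hh =>
    obtain ⟨i, j, k, rfl⟩ := hg
    obtain ⟨i', j', k', rfl⟩ := hh
    obtain ⟨m, hm⟩ := commutator_le_zpowers.{u} (Subgroup.commutator_mem_commutator
      (Subgroup.mem_top (y ^ j)) (Subgroup.mem_top (x ^ i')))
    have hyx : y.{u} ^ j * x ^ i' = groupComm x y ^ m * (x ^ i' * y ^ j) := by
      dsimp only at hm
      rw [hm, commutatorElement_def]
      group
    refine ⟨i + i', j + j', k + k' + m, ?_⟩
    calc x ^ i * y ^ j * groupComm x y ^ k * (x ^ i' * y ^ j' * groupComm x y ^ k')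
        = x ^ i * (y ^ j * (groupComm x y ^ k * x ^ i')) * y ^ j' * groupComm x y ^ k' := by group
      _ = x ^ i * (y ^ j * x ^ i') * (groupComm x y ^ k * y ^ j') * groupComm x y ^ k' := by
          rw [((hz _).zpow_left k).eq]; group
      _ = x ^ i * (groupComm x y ^ m * (x ^ i' * y ^ j * y ^ j' * groupComm x y ^ k)) *
            groupComm x y ^ k' := by
          rw [((hz _).zpow_left k).eq, hyx]; group
      _ = _ := by
          rw [((hz _).zpow_left m).eq, zpow_add, zpow_add, zpow_add, zpow_add]; group

/-- The homomorphism from the free nilpotent group of class two to a group of class at most two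
with prescribed values at the two generators. -/
def lift {K : Type*} [Group K] (hK : (⊤ : Subgroup K).lowerCentralSeries 2 = ⊥) (a b : K) :
    FreeNilTwo.{u} →* K :=
  QuotientGroup.lift _ (FreeGroup.lift fun i : ULift.{u} (Fin 2) => ![a, b] i.down) (by
    rw [← Subgroup.map_eq_bot_iff, eq_bot_iff, ← hK, Subgroup.map_lowerCentralSeries]
    exact Subgroup.lowerCentralSeries_mono 2 le_top)

section

variable {K : Type*} [Group K] (hK : (⊤ : Subgroup K).lowerCentralSeries 2 = ⊥) (a b : K)

@[simp]
theorem lift_x : lift.{u} hK a b x = a := by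
  change FreeGroup.lift _ (FreeGroup.of _) = a
  simp

@[simp]
theorem lift_y : lift.{u} hK a b y = b := by
  change FreeGroup.lift _ (FreeGroup.of _) = b
  simp

end

/-- The homomorphism to the Heisenberg group sending the generators to the elementary matrices. -/
def toHeisenberg (R : Type*) [CommRing R] : FreeNilTwo.{u} →* HeisenbergGroup R :=
  lift HeisenbergGroup.lowerCentralSeries_two ⟨1, 0, 0⟩ ⟨0, 1, 0⟩

section

variable (R : Type*) [CommRing R]

theorem toHeisenberg_x_zpow (n : ℤ) : toHeisenberg.{u} R (x ^ n) = ⟨n, 0, 0⟩ := by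
  rw [map_zpow, toHeisenberg, lift_x, HeisenbergGroup.mk_zpow (by simp)]
  simp

theorem toHeisenberg_y_zpow (n : ℤ) : toHeisenberg.{u} R (y ^ n) = ⟨0, n, 0⟩ := by
  rw [map_zpow, toHeisenberg, lift_y, HeisenbergGroup.mk_zpow (by simp)]
  simp

theorem toHeisenberg_groupComm_zpow (n : ℤ) :
    toHeisenberg.{u} R (groupComm x y ^ n) = ⟨0, 0, n⟩ := by
  have : toHeisenberg.{u} R (groupComm x y) = ⟨0, 0, 1⟩ := by
    rw [map_groupComm, toHeisenberg, lift_x, lift_y]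
    simp [groupComm, HeisenbergGroup.mul_def, HeisenbergGroup.inv_def]
  rw [map_zpow, this, HeisenbergGroup.mk_zpow (by simp)]
  simp

end

theorem mem_closure_of_toHeisenberg_eq_one {p : ℕ} (R : Type*) [CommRing R] [CharP R p]
    {g : FreeNilTwo.{u}} (hg : toHeisenberg R g = 1) :
    g ∈ Subgroup.closure {x ^ p, y ^ p, groupComm x y ^ p} := by
  obtain ⟨i, j, k, rfl⟩ := exists_eq_zpow_mul g
  rw [map_mul, map_mul, toHeisenberg_x_zpow, toHeisenberg_y_zpow, toHeisenberg_groupComm_zpow]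
    at hg
  simp only [HeisenbergGroup.mul_def, HeisenbergGroup.one_def, HeisenbergGroup.mk.injEq] at hg
  obtain ⟨hi, hj, hk⟩ := hg
  rw [add_zero, add_zero] at hi
  rw [zero_add, add_zero] at hj
  rw [hi] at hk
  simp only [add_zero, zero_add, zero_mul, mul_zero] at hk
  rw [CharP.intCast_eq_zero_iff R p] at hi hj hk
  obtain ⟨i, rfl⟩ := hi
  obtain ⟨j, rfl⟩ := hj
  obtain ⟨k, rfl⟩ := hk
  simp only [zpow_mul, zpow_natCast]
  exact mul_mem (mul_mem (zpow_mem (Subgroup.subset_closure (by simp)) _)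
    (zpow_mem (Subgroup.subset_closure (by simp)) _))
    (zpow_mem (Subgroup.subset_closure (by simp)) _)

theorem dominion_powers_le {p : ℕ} :
    dominion (nilpotentGroups.{u} 2) (powers p) ≤
      Subgroup.closure {x ^ p, y ^ p, groupComm x y ^ p} := by
  intro g hg
  have hle : powers.{u} p ≤ (toHeisenberg (ULift.{u} (ZMod p))).ker := by
    have hp : ((p : ℤ) : ULift.{u} (ZMod p)) = 0 := (CharP.intCast_eq_zero_iff _ p _).mpr dvd_rfl
    rw [powers, Subgroup.closure_le]
    rintro _ (rfl | rfl)
    · rw [SetLike.mem_coe, MonoidHom.mem_ker, ← zpow_natCast, toHeisenberg_x_zpow, hp]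
      rfl
    · rw [SetLike.mem_coe, MonoidHom.mem_ker, ← zpow_natCast, toHeisenberg_y_zpow, hp]
      rfl
  exact mem_closure_of_toHeisenberg_eq_one (ULift.{u} (ZMod p))
    (hg (GrpCat.of (HeisenbergGroup (ULift.{u} (ZMod p))))
      HeisenbergGroup.lowerCentralSeries_two (toHeisenberg _) 1 fun h hh => hle hh)

theorem groupComm_pow_notMem_powers {p : ℕ} (hp : p.Prime) :
    groupComm x.{u} y ^ p ∉ powers p := by
  -- Closed under products because the cross term `fst * snd` is divisible by `p^2`.
  let P : Subgroup (HeisenbergGroup ℤ) :=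
    { carrier := {g | (p : ℤ) ∣ g.fst ∧ (p : ℤ) ∣ g.snd ∧ (p : ℤ) * p ∣ g.corner}
      one_mem' := ⟨dvd_zero _, dvd_zero _, dvd_zero _⟩
      mul_mem' := fun ha hb => ⟨dvd_add ha.1 hb.1, dvd_add ha.2.1 hb.2.1,
        dvd_add (dvd_add ha.2.2 hb.2.2) (mul_dvd_mul ha.1 hb.2.1)⟩
      inv_mem' := fun ha => ⟨ha.1.neg_right, ha.2.1.neg_right,
        dvd_add ha.2.2.neg_right (mul_dvd_mul ha.1 ha.2.1)⟩ }
  have hle : powers.{u} p ≤ P.comap (toHeisenberg ℤ) := by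
    rw [powers, Subgroup.closure_le]
    rintro _ (rfl | rfl)
    · rw [SetLike.mem_coe, Subgroup.mem_comap, ← zpow_natCast, toHeisenberg_x_zpow]
      exact ⟨dvd_rfl, dvd_zero _, dvd_zero _⟩
    · rw [SetLike.mem_coe, Subgroup.mem_comap, ← zpow_natCast, toHeisenberg_y_zpow]
      exact ⟨dvd_zero _, dvd_rfl, dvd_zero _⟩
  intro h
  have h := hle h
  rw [Subgroup.mem_comap, ← zpow_natCast, toHeisenberg_groupComm_zpow] at h
  have h : (p : ℤ) * p ∣ p := h.2.2
  have h : p * p ∣ p := by exact_mod_cast h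
  have := Nat.le_of_dvd hp.pos h
  nlinarith [hp.two_le]

theorem closure_le_dominion_powers {c p : ℕ} (hp : p.Prime) (hcp : c ≤ p) :
    Subgroup.closure {x ^ p, y ^ p, groupComm x y ^ p} ≤
      dominion (nilpotentGroups.{u} c) (powers p) := by
  have hx : x.{u} ^ p ∈ powers p := Subgroup.subset_closure (by simp)
  have hy : y.{u} ^ p ∈ powers p := Subgroup.subset_closure (by simp)
  rw [Subgroup.closure_le]
  rintro _ (rfl | rfl | rfl)
  · exact le_dominion _ _ hx
  · exact le_dominion _ _ hy
  · intro C hC f g hfg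
    have hfx := hfg _ hx
    have hfy := hfg _ hy
    -- Inverses are taken so that the quotient `a⁻¹ * a'` is `f x * (g x)⁻¹`.
    have hcomm := Subgroup.commute_inv_mul_pow_of_pow_eq hp
      (nilpotentGroups_mono hcp C hC) (a := (f x)⁻¹) (a' := (g x)⁻¹)
      (by rw [inv_pow, inv_pow, ← map_pow, ← map_pow, hfx]) (f y)
    rw [← map_pow] at hcomm
    rw [groupComm_pow_right lowerCentralSeries_two, map_groupComm, map_groupComm, ← hfy, groupComm,
      groupComm, mul_left_inj]
    have h := hcomm.inv_right.eq
    rw [inv_inv] at h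
    rw [mul_assoc, inv_mul_eq_iff_eq_mul, ← mul_assoc, ← mul_assoc, h]
    group

end FreeNilTwo

/-! ### The main theorem -/

theorem theorem7p78 (c : ℕ) (hc : 1 < c) :
    (∀ p : ℕ, p.Prime → c ≤ p →
      dominion (nilpotentGroups.{u} c) (FreeNilTwo.powers p) =
          Subgroup.closure {FreeNilTwo.x ^ p, FreeNilTwo.y ^ p,
            groupComm FreeNilTwo.x FreeNilTwo.y ^ p} ∧
        dominion (nilpotentGroups.{u} c) (FreeNilTwo.powers p) =
          dominion (nilpotentGroups.{u} 2) (FreeNilTwo.powers p) ∧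
        FreeNilTwo.powers.{u} p < dominion (nilpotentGroups.{u} c) (FreeNilTwo.powers p)) ∧
    (∀ V : ObjectProperty GrpCat.{u}, nilpotentGroups 2 ≤ V → V ≤ nilpotentGroups c →
      HasNontrivialDominions V ∧
        ∀ p : ℕ, p.Prime → c ≤ p →
          FreeNilTwo.powers.{u} p < dominion (nilpotentGroups.{u} 2) (FreeNilTwo.powers p) ∧
          dominion (nilpotentGroups.{u} 2) (FreeNilTwo.powers p) =
            dominion V (FreeNilTwo.powers p)) := by
  have hmono := fun p : ℕ =>
    dominion_antitone (nilpotentGroups_mono.{u} (show 2 ≤ c from hc)) (FreeNilTwo.powers.{u} p)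
  have heq : ∀ p : ℕ, p.Prime → c ≤ p → dominion (nilpotentGroups.{u} c) (FreeNilTwo.powers p) =
      dominion (nilpotentGroups.{u} 2) (FreeNilTwo.powers p) := fun p hp hcp =>
    le_antisymm (hmono _)
      (FreeNilTwo.dominion_powers_le.trans (FreeNilTwo.closure_le_dominion_powers hp hcp))
  have hlt : ∀ p : ℕ, p.Prime → c ≤ p →
      FreeNilTwo.powers.{u} p < dominion (nilpotentGroups.{u} c) (FreeNilTwo.powers p) :=
    fun p hp hcp => lt_of_le_not_ge (le_dominion _ _) fun h =>
      FreeNilTwo.groupComm_pow_notMem_powers hp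
        (h (FreeNilTwo.closure_le_dominion_powers hp hcp (Subgroup.subset_closure (by simp))))
  have hV : ∀ V : ObjectProperty GrpCat.{u}, nilpotentGroups 2 ≤ V → V ≤ nilpotentGroups c →
      ∀ p : ℕ, p.Prime → c ≤ p →
        dominion (nilpotentGroups.{u} 2) (FreeNilTwo.powers p) =
          dominion V (FreeNilTwo.powers p) := fun V h2 hVc p hp hcp =>
    le_antisymm (heq p hp hcp ▸ dominion_antitone hVc _) (dominion_antitone h2 _)
  refine ⟨fun p hp hcp => ⟨le_antisymm ((hmono _).trans FreeNilTwo.dominion_powers_le)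
    (FreeNilTwo.closure_le_dominion_powers hp hcp), heq p hp hcp, hlt p hp hcp⟩,
    fun V h2 hVc => ⟨?_, fun p hp hcp => ⟨heq p hp hcp ▸ hlt p hp hcp, hV V h2 hVc p hp hcp⟩⟩⟩
  obtain ⟨p, hcp, hp⟩ := Nat.exists_infinite_primes c
  refine ⟨GrpCat.of FreeNilTwo.{u}, h2 _ FreeNilTwo.mem_nilpotentGroups, FreeNilTwo.powers p, ?_⟩
  have := hlt p hp hcp
  rw [heq p hp hcp, hV V h2 hVc p hp hcp] at this
  exact this.ne'
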